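/- **Setting.** Let $X\subseteq\{0,1\}^n$, $f:X\to\{0,1\}$, and let $v_{x,j}\in\mathbb C^m$ ($x\in X$, $j\in[n]$) be any vectors. Put $A=\max_{x\in X}\sum_{j}\|v_{x,j}\|^2$ (the size of the vector set; $m$ is its dimension) and assume $A\ge 1$. Fix a constant $c\ge 100$. In $\mathbb C|\hat 0\rangle\oplus(\mathbb C^n\otimes\mathbb C^m\otimes\mathbb C^2)$ define $$|\psi_x\rangle=\frac1{\sqrt{\nu_x}}\Big(|\hat0\rangle+\frac1{\sqrt{cA}}\sum_{i\in[n]}|i\rangle|v_{x,i}\rangle|x_i\rangle\Big)\ \ (f(x)=1),\qquad |\phi_y\rangle=\frac1{\sqrt{\mu_y}}\Big(|\hat0\rangle-\sqrt{cA}\sum_{i\in[n]}|i\rangle|v_{y,i}\rangle|\bar y_i\rangle\Big)\ \ (f(y)=0),$$ where $\nu_x=1+\frac1{cA}\sum_i\|v_{x,i}\|^2$ and $\mu_y=1+cA\sum_i\|v_{y,i}\|^2$ normalize the vectors. Let $$\varepsilon=\max_{x,y\in X:\ f(x)=1,\ f(y)=0}|\langle\psi_x|\phi_y\rangle|$$ (with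 $\varepsilon=0$ if there is no such pair), let $n_1=|\{x\in X:f(x)=1\}|$, let $M$ be the matrix with rows $|\psi_x\rangle$, $f(x)=1$, let $\kappa$ be its rank, and let $s_1\ge s_2\ge\dots\ge s_\kappa>s_{\kappa+1}:=0$ be its singular values. **Query algorithms.** A quantum query algorithm with $T$ queries acts on a space $\mathbb C^n\otimes\mathbb C^2\otimes\mathbb C^W$ of dimension $S=2nW$. It prepares $U_TO_xU_{T-1}O_x\cdots U_1O_xU_0|\hat 0\rangle$, where now $|\hat0\rangle$ is a fixed basis state, the $U_t$ are unitaries that do not depend on $x$, and $O_x|i\rangle|b\rangle|w\rangle=|i\rangle|b\oplus x_i\rangle|w\rangle$. It then outputs a bit by a two-outcome measurement. It uses $\lceil\log_2S\rceil$ qubits. **Theorem.** For every $c\ge100$ there is a constant $C>0$, depending only on $c$, such that the following holds for all $n,m,X,f$ and $\{v_{x,j}\}$ as above. If there is $\kappa^*\in[\kappa]$ with $$\varepsilon\le\frac1{\sqrt{n_1}}\Big(\frac{s_{\kappa^*}}{2\sqrt c\,A}-s_{\kappa^*+1}\Big)\qquad\text{and}\qquad s_{\kappa^*+1}\le\frac1{2\sqrt{1000c}\,A},$$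 then there is a quantum query algorithm that outputs $f(x)$ with probability at least $2/3$ for every $x\in X$, that makes at most $C A$ queries, and that uses at most $C(1+\log_2(nm))$ qubits. -/

import Mathlib

noncomputable section

namespace DualAdversary

/-! ### Quantum query algorithms on `n`-bit inputs -/

/-- Computational basis of the space `ℂⁿ ⊗ ℂ² ⊗ ℂᵂ`: query index, query bit, workspace. -/
abbrev Basis (n W : ℕ) : Type := Fin n × Bool × Fin W

/-- The permutation `(i, b, w) ↦ (i, b ⊕ xᵢ, w)` of the computational basis. -/
def oraclePerm {n : ℕ} (W : ℕ) (x : Fin n → Bool) : Equiv.Perm (Basis n W) where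
  toFun p := (p.1, xor p.2.1 (x p.1), p.2.2)
  invFun p := (p.1, xor p.2.1 (x p.1), p.2.2)
  left_inv p := by simp
  right_inv p := by simp

/-- The oracle `Oₓ ⊗ I`, the unitary with `|i⟩|b⟩|w⟩ ↦ |i⟩|b ⊕ xᵢ⟩|w⟩`. -/
def oracle {n : ℕ} (W : ℕ) (x : Fin n → Bool) :
    EuclideanSpace ℂ (Basis n W) ≃ₗᵢ[ℂ] EuclideanSpace ℂ (Basis n W) :=
  LinearIsometryEquiv.piLpCongrLeft 2 ℂ ℂ (oraclePerm W x)

/-- A quantum query algorithm `U_T Oₓ U_{T-1} Oₓ ⋯ U₁ Oₓ U₀ |init⟩` on `ℂⁿ ⊗ ℂ² ⊗ ℂᵂ`, followed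
by a two-outcome measurement in the computational basis (the unitary `U_T` can be used to change
the basis of the measurement, and `U₀` to prepare any initial state). The unitaries do not depend
on the input `x`; those with an index greater than `T` play no role. -/
structure QueryAlgorithm (n : ℕ) where
  /-- the number `T` of applications of the oracle -/
  queries : ℕ
  /-- the dimension `W` of the workspace -/
  work : ℕ
  /-- the unitaries `U₀, U₁, …, U_T` -/
  U : ℕ → (EuclideanSpace ℂ (Basis n work) ≃ₗᵢ[ℂ] EuclideanSpace ℂ (Basis n work))
  /-- the initial basis state -/
  init : Basis n work
  /-- the output announced when the final measurement gives a basis state -/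
  output : Basis n work → Bool

namespace QueryAlgorithm

variable {n : ℕ}

/-- The state `U_t Oₓ ⋯ U₁ Oₓ U₀ |init⟩` after `t` queries. -/
def state (𝒜 : QueryAlgorithm n) (x : Fin n → Bool) : ℕ → EuclideanSpace ℂ (Basis n 𝒜.work)
  | 0 => 𝒜.U 0 (EuclideanSpace.single 𝒜.init 1)
  | t + 1 => 𝒜.U (t + 1) (oracle 𝒜.work x (state 𝒜 x t))

/-- The probability that the algorithm outputs the bit `b` on input `x`. -/
def prob (𝒜 : QueryAlgorithm n) (x : Fin n → Bool) (b : Bool) : ℝ :=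
  ∑ p : Basis n 𝒜.work with 𝒜.output p = b, ‖𝒜.state x 𝒜.queries p‖ ^ 2

/-- The number of qubits `⌈log₂ S⌉`, where `S` is the dimension of the space that the algorithm
acts on (oracle registers included). -/
def qubits (𝒜 : QueryAlgorithm n) : ℕ := Nat.clog 2 (Fintype.card (Basis n 𝒜.work))

/-- The algorithm evaluates `f` with probability at least `2/3` on every input in the domain. -/
def Evaluates (𝒜 : QueryAlgorithm n) {X : Finset (Fin n → Bool)} (f : X → Bool) : Prop :=
  ∀ x : X, 2 / 3 ≤ 𝒜.prob x (f x)

end QueryAlgorithm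

/-! ### Vector sets and the states built from them -/

variable {n m : ℕ} {X : Finset (Fin n → Bool)}

/-- `∑ⱼ ‖v_{x,j}‖²`. -/
def weight (v : X → Fin n → EuclideanSpace ℂ (Fin m)) (x : X) : ℝ := ∑ j, ‖v x j‖ ^ 2

/-- The size `A = max_{x ∈ X} ∑ⱼ ‖v_{x,j}‖²` of a vector set. -/
def size (v : X → Fin n → EuclideanSpace ℂ (Fin m)) : ℝ := ⨆ x : X, weight v x

/-- Computational basis of `ℋ = ℂ ⊕ ℂⁿ ⊗ ℂᵐ ⊗ ℂ²`; the element of `Unit` is the label `0̂`. -/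
abbrev HBasis (n m : ℕ) : Type := Unit ⊕ (Fin n × Fin m × Bool)

/-- `|0̂⟩ + a ∑ᵢ |i⟩|v_{x,i}⟩|z_i⟩`. -/
def combine (a : ℂ) (v : Fin n → EuclideanSpace ℂ (Fin m)) (z : Fin n → Bool) :
    EuclideanSpace ℂ (HBasis n m) :=
  WithLp.toLp 2 (Sum.elim (fun _ => 1) fun p => if p.2.2 = z p.1 then a * v p.1 p.2.1 else 0)

/-- `ν_x = 1 + (1 / (c A)) ∑ᵢ ‖v_{x,i}‖²`. -/
def nu (c : ℝ) (v : X → Fin n → EuclideanSpace ℂ (Fin m)) (x : X) : ℝ :=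
  1 + 1 / (c * size v) * weight v x

/-- `μ_x = 1 + c A ∑ᵢ ‖v_{x,i}‖²`. -/
def mu (c : ℝ) (v : X → Fin n → EuclideanSpace ℂ (Fin m)) (x : X) : ℝ :=
  1 + c * size v * weight v x

/-- `|ψ_x⟩ = (1/√ν_x) (|0̂⟩ + (1/√(c A)) ∑ᵢ |i⟩|v_{x,i}⟩|x_i⟩)`. -/
def psi (c : ℝ) (v : X → Fin n → EuclideanSpace ℂ (Fin m)) (x : X) :
    EuclideanSpace ℂ (HBasis n m) :=
  ((1 / √(nu c v x) : ℝ) : ℂ) •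
    combine ((1 / √(c * size v) : ℝ) : ℂ) (v x) (x : Fin n → Bool)

/-- `|φ_x⟩ = (1/√μ_x) (|0̂⟩ - √(c A) ∑ᵢ |i⟩|v_{x,i}⟩|x̄_i⟩)`, with `x̄_i` the negation of `x_i`. -/
def phi (c : ℝ) (v : X → Fin n → EuclideanSpace ℂ (Fin m)) (x : X) :
    EuclideanSpace ℂ (HBasis n m) :=
  ((1 / √(mu c v x) : ℝ) : ℂ) •
    combine (-((√(c * size v) : ℝ) : ℂ)) (v x) (fun i => !(x : Fin n → Bool) i)

/-- `max |⟨ψ_x|φ_y⟩|` over `x, y ∈ X` with `f(x) = 1` and `f(y) = 0` (and `0` if there is no such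
pair). -/
def crossError (c : ℝ) (f : X → Bool) (v : X → Fin n → EuclideanSpace ℂ (Fin m)) : ℝ :=
  ⨆ p : {x : X // f x = true} × {y : X // f y = false},
    ‖inner ℂ (psi c v p.1.1) (phi c v p.2.1)‖

/-- The matrix whose rows are the vectors `|ψ_x⟩`, for `f(x) = 1`. -/
def psiMatrix (c : ℝ) (f : X → Bool) (v : X → Fin n → EuclideanSpace ℂ (Fin m)) :
    Matrix {x : X // f x = true} (HBasis n m) ℂ :=
  Matrix.of fun x k => psi c v x.1 k

/-- The singular value `s_i` of `M`, `i = 1, 2, …`, in decreasing order with multiplicity, and `0`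
for `i > rank M` (Mathlib counts from `0`). -/
def singVal {ι κ : Type*} [Fintype ι] [Fintype κ] [DecidableEq κ] (M : Matrix ι κ ℂ) (i : ℕ) : ℝ :=
  (Matrix.toEuclideanLin M).singularValues (i - 1)

end DualAdversary

end

noncomputable section

namespace DualAdversary

/-! Let `V` be spanned by the right singular vectors of `M` for its `κ` largest singular values,
with orthogonal projection `P`. Let `U` be the reflection about the span of `|0̂⟩` and the
`|i⟩|·⟩|x_i⟩`, followed by the reflection about `V`.

If `f x = 1`, the unnormalized conjugate of `ψ_x` is fixed by the first reflection and has distance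
of order `s_{κ+1}` from `V`. Hence it is almost fixed by `U`, and it is also close to `|0̂⟩`. If `f
x = 0`, the unnormalized conjugate `g` of `φ_x` satisfies `U g = 2 U|0̂⟩ + g - 2 P g`, and `P g` is
short because `s_κ ‖P (conj φ_x)‖ ≤ √n₁ ε`. So, up to a small error, `|0̂⟩` is a difference `(g -
U⁻¹ g) / 2` with `‖g‖² ≤ 1 + c A²`, which leaves little weight on eigenvalues of `U` near `1`. Both
facts about `V` are in `singularSpace_psiMatrix`.

Standard phase estimation would separate the two cases, at the price of a register of about `log A`
qubits. Here a single control qubit is turned by `π / (2T)` before each of `T ≈ 8 √c A` controlled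
uses of `U`. On an almost fixed vector the turns add up to a flip (`norm_fst_step_pow_le`);
otherwise the control qubit stays near `|0⟩` (`norm_snd_step_pow_le`, proved by commutation alone,
without a spectral decomposition of `U`). Reading the control qubit gives `f x`. -/

/-! ### Slow rotation of a control qubit, interleaved with a controlled unitary -/

section SlowRotation

variable {H : Type*} [NormedAddCommGroup H] [InnerProductSpace ℂ H]

/-- The squared norm of `|0⟩p + |1⟩q`. -/
def pairNormSq (z : H × H) : ℝ := ‖z.1‖ ^ 2 + ‖z.2‖ ^ 2

/-- The rotation `|0⟩p + |1⟩q ↦ |0⟩(cos δ p - sin δ q) + |1⟩(sin δ p + cos δ q)`. -/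
def pairRotation (H : Type*) [NormedAddCommGroup H] [InnerProductSpace ℂ H] (δ : ℝ) :
    Module.End ℂ (H × H) :=
  LinearMap.prod
    ((Real.cos δ : ℂ) • LinearMap.fst ℂ H H - (Real.sin δ : ℂ) • LinearMap.snd ℂ H H)
    ((Real.sin δ : ℂ) • LinearMap.fst ℂ H H + (Real.cos δ : ℂ) • LinearMap.snd ℂ H H)

/-- The controlled unitary `|0⟩p + |1⟩q ↦ |0⟩p + |1⟩Uq`. -/
def pairControl (U : H ≃ₗᵢ[ℂ] H) : Module.End ℂ (H × H) :=
  LinearMap.prodMap LinearMap.id U.toLinearEquiv.toLinearMap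

/-- The unitary `|0⟩p + |1⟩q ↦ |0⟩Up + |1⟩Uq`. -/
def pairDiag (U : H ≃ₗᵢ[ℂ] H) : Module.End ℂ (H × H) :=
  LinearMap.prodMap U.toLinearEquiv.toLinearMap U.toLinearEquiv.toLinearMap

/-- A rotation of the control qubit followed by the controlled unitary. -/
def pairStep (U : H ≃ₗᵢ[ℂ] H) (δ : ℝ) : Module.End ℂ (H × H) :=
  pairControl U * pairRotation H δ

@[simp] lemma pairRotation_apply (δ : ℝ) (z : H × H) :
    pairRotation H δ z = ((Real.cos δ : ℂ) • z.1 - (Real.sin δ : ℂ) • z.2,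
      (Real.sin δ : ℂ) • z.1 + (Real.cos δ : ℂ) • z.2) := rfl

@[simp] lemma pairControl_apply (U : H ≃ₗᵢ[ℂ] H) (z : H × H) :
    pairControl U z = (z.1, U z.2) := rfl

@[simp] lemma pairDiag_apply (U : H ≃ₗᵢ[ℂ] H) (z : H × H) :
    pairDiag U z = (U z.1, U z.2) := rfl

lemma pairStep_apply (U : H ≃ₗᵢ[ℂ] H) (δ : ℝ) (z : H × H) :
    pairStep U δ z = ((Real.cos δ : ℂ) • z.1 - (Real.sin δ : ℂ) • z.2,
      U ((Real.sin δ : ℂ) • z.1 + (Real.cos δ : ℂ) • z.2)) := rfl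

/-- The cross terms cancel. Isometry is stated with `pairNormSq` because the built-in norm on `H ×
H` is the sup norm. -/
lemma pairNormSq_rotation (δ : ℝ) (z : H × H) :
    pairNormSq (pairRotation H δ z) = pairNormSq z := by
  obtain ⟨p, q⟩ := z
  simp only [pairNormSq, pairRotation_apply]
  rw [@norm_sub_sq ℂ, @norm_add_sq ℂ]
  simp only [inner_smul_left, inner_smul_right, norm_smul, Complex.norm_real, Complex.conj_ofReal,
    Real.norm_eq_abs, mul_pow, sq_abs]
  have h := Real.sin_sq_add_cos_sq δ
  have e : (Real.sin δ : ℂ) * ((Real.cos δ : ℂ) * inner ℂ p q)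
    = (Real.cos δ : ℂ) * ((Real.sin δ : ℂ) * inner ℂ p q) := by ring
  rw [e]
  linear_combination (‖p‖ ^ 2 + ‖q‖ ^ 2) * h

lemma pairNormSq_control (U : H ≃ₗᵢ[ℂ] H) (z : H × H) :
    pairNormSq (pairControl U z) = pairNormSq z := by
  simp [pairNormSq]

lemma pairNormSq_step (U : H ≃ₗᵢ[ℂ] H) (δ : ℝ) (z : H × H) :
    pairNormSq (pairStep U δ z) = pairNormSq z := by
  rw [pairStep, Module.End.mul_apply, pairNormSq_control, pairNormSq_rotation]

lemma pairNormSq_step_pow (U : H ≃ₗᵢ[ℂ] H) (δ : ℝ) (t : ℕ) (z : H × H) :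
    pairNormSq ((pairStep U δ ^ t) z) = pairNormSq z := by
  induction t with
  | zero => simp
  | succ t ih => rw [pow_succ', Module.End.mul_apply, pairNormSq_step, ih]

lemma commute_pairStep_pairDiag (U : H ≃ₗᵢ[ℂ] H) (δ : ℝ) :
    Commute (pairStep U δ) (pairDiag U) := by
  refine LinearMap.ext fun z => ?_
  simp [Module.End.mul_apply, pairStep_apply]

/-- If `U` has no almost fixed vector near `z`, in the sense that `z` is up to the error `η` the
image of a short vector `-g / 2` under `U⁻¹ - 1`, then the control qubit is hardly excited. -/
lemma norm_snd_step_pow_le (U : H ≃ₗᵢ[ℂ] H) (δ : ℝ) (hs : Real.sin δ ≠ 0) (T : ℕ) {z g η : H}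
    (hg : U g = (2 : ℂ) • U z + g - (2 : ℂ) • η) :
    Real.cos δ ^ 2 * ‖((pairStep U δ ^ T) (z, 0)).2‖ ^ 2 ≤
      Real.sin δ ^ 2 * ‖g‖ ^ 2 + Real.cos δ ^ 2 * ‖η‖ ^ 2 := by
  set M := pairStep U δ ^ T with hM
  set C : ℂ := (Real.cos δ : ℂ) with hC
  set s : ℂ := (Real.sin δ : ℂ) with hsdef
  have hs' : s ≠ 0 := Complex.ofReal_ne_zero.2 hs
  have hMS : ∀ w, M (pairStep U δ w) = pairStep U δ (M w) := fun w =>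
    congrArg (fun L : Module.End ℂ (H × H) => L w)
      ((Commute.refl (pairStep U δ)).pow_left T).eq
  have hMU : ∀ w, M (pairDiag U w) = pairDiag U (M w) := fun w =>
    congrArg (fun L : Module.End ℂ (H × H) => L w) ((commute_pairStep_pairDiag U δ).pow_left T).eq
  -- Write `M` as a block matrix: `M (y, 0) = (a y, b y)` and `M (0, y) = (e y, d y)`. All blocks
  -- commute with `U`, and `b z` is the quantity to bound.
  have split : ∀ p q : H, M (p, q) = M (p, 0) + M (0, q) := fun p q => by
    rw [← map_add]; simp
  have sm0 : ∀ (r : ℂ) (p : H), M (r • p, 0) = r • M (p, 0) := fun r p => by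
    rw [← map_smul]; simp
  have sm1 : ∀ (r : ℂ) (p : H), M (0, r • p) = r • M (0, p) := fun r p => by
    rw [← map_smul]; simp
  have hUa : ∀ y, M (U y, 0) = (U (M (y, 0)).1, U (M (y, 0)).2) := fun y => by
    simpa using hMU (y, 0)
  have hUd : ∀ y, M (0, U y) = (U (M (0, y)).1, U (M (0, y)).2) := fun y => by
    simpa using hMU (0, y)
  have key : ∀ y, C • M (y, 0) + s • M (0, U y) =
      (C • (M (y, 0)).1 - s • (M (y, 0)).2, U (s • (M (y, 0)).1 + C • (M (y, 0)).2)) := fun y => by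
    have := hMS (y, 0)
    rw [pairStep_apply, pairStep_apply, split, ← hC, ← hsdef] at this
    simpa [sm0, sm1] using this
  -- Comparing first components in `M S = S M` gives `e U = -b`; this is where `sin δ ≠ 0` is
  -- needed.
  have hb' : ∀ y, (M (0, U y)).1 = -(M (y, 0)).2 := fun y => by
    have h1 := congrArg Prod.fst (key y)
    simp only [Prod.fst_add, Prod.smul_fst] at h1
    have h2 : s • ((M (0, U y)).1 + (M (y, 0)).2) = 0 := by
      rw [smul_add]; linear_combination (norm := module) h1
    exact eq_neg_of_add_eq_zero_left ((smul_eq_zero.1 h2).resolve_left hs')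
  -- Second components: `cos δ (1 - U) b = sin δ U (a - d)`. On the image of `1 - U`, the block `b`
  -- is therefore of order `tan δ`.
  have had : ∀ y, C • ((M (y, 0)).2 - U (M (y, 0)).2) =
      s • U ((M (y, 0)).1 - (M (0, y)).2) := fun y => by
    have h1 := congrArg Prod.snd (key y)
    simp only [Prod.snd_add, Prod.smul_snd, hUd, map_add, map_smul] at h1
    simp only [map_sub, smul_sub]
    linear_combination (norm := module) h1
  -- Both terms come from the same two unit-cost inputs `(P, -U Q)` and `(-Q, P)`, so the two errors
  -- add in squares and not by the triangle inequality.
  have contr : ∀ P Q : H, ‖(M (P, 0)).1 - (M (0, P)).2 + (2 : ℂ) • (M (Q, 0)).2‖ ^ 2 ≤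
      4 * (‖P‖ ^ 2 + ‖Q‖ ^ 2) := fun P Q => by
    have e : (M (P, 0)).1 - (M (0, P)).2 + (2 : ℂ) • (M (Q, 0)).2 =
        (M (P, -U Q)).1 - (M (-Q, P)).2 := by
      rw [split P (-U Q), split (-Q) P]
      have n0 : M (-Q, 0) = -M (Q, 0) := by simpa using sm0 (-1) Q
      have n1 : M (0, -U Q) = -M (0, U Q) := by simpa using sm1 (-1) (U Q)
      rw [n0, n1]
      simp only [Prod.fst_add, Prod.snd_add, Prod.fst_neg, Prod.snd_neg, hb', two_smul]
      abel
    rw [e]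
    have N1 := pairNormSq_step_pow U δ T (P, -U Q)
    have N2 := pairNormSq_step_pow U δ T (-Q, P)
    rw [← hM] at N1 N2
    simp only [pairNormSq, norm_neg, LinearIsometryEquiv.norm_map] at N1 N2
    have t := norm_sub_le (M (P, -U Q)).1 (M (-Q, P)).2
    have t0 := norm_nonneg ((M (P, -U Q)).1 - (M (-Q, P)).2)
    nlinarith [sq_nonneg (‖(M (P, -U Q)).1‖ - ‖(M (-Q, P)).2‖), sq_nonneg ‖(M (P, -U Q)).2‖,
      sq_nonneg ‖(M (-Q, P)).1‖]
  obtain ⟨η', rfl⟩ := U.surjective η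
  -- Since `z = (g - U⁻¹ g) / 2 + η'`, the relation `had` turns `2 cos δ b z` into `-sin δ (a - d) g
  -- + 2 cos δ b η'`.
  have main : ((2 : ℂ) * C) • (M (z, 0)).2 =
      (M (-s • g, 0)).1 - (M (0, -s • g)).2 + (2 : ℂ) • (M (C • η', 0)).2 := by
    apply U.injective
    have h1 : (2 : ℂ) • U z = U g - g + (2 : ℂ) • U η' := by rw [hg]; abel
    have h2 : M ((2 : ℂ) • U z, 0) = M (U g, 0) - M (g, 0) + (2 : ℂ) • M (U η', 0) := by
      rw [h1, ← sm0, ← map_sub, ← map_add]; simp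
    rw [sm0, hUa, hUa, hUa] at h2
    have h3 := congrArg Prod.snd h2
    simp only [Prod.snd_add, Prod.snd_sub, Prod.smul_snd] at h3
    have h4 := had g
    simp only [sm0, sm1, Prod.smul_fst, Prod.smul_snd, map_add, map_sub, map_smul,
      smul_sub] at h4 ⊢
    rw [mul_comm, mul_smul, h3]
    simp only [smul_add, smul_sub, smul_comm (2 : ℂ) C]
    linear_combination (norm := module) -h4
  have fin := contr (-s • g) (C • η')
  rw [← main] at fin
  simp only [neg_smul, norm_neg, norm_smul, norm_mul, mul_pow, hC, hsdef, Complex.norm_real,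
    Real.norm_eq_abs, sq_abs, Complex.norm_ofNat] at fin
  rw [LinearIsometryEquiv.norm_map]
  linarith

/-- If `z` is close to an almost fixed vector of `U`, then the control qubit follows the
rotation. -/
lemma norm_fst_step_pow_le (U : H ≃ₗᵢ[ℂ] H) (T : ℕ) (hT : T ≠ 0) {z u : H} {d : ℝ}
    (hd : ‖U (z + u) - (z + u)‖ ≤ d) :
    ‖((pairStep U (Real.pi / (2 * T)) ^ T) (z, 0)).1‖ ≤ ‖u‖ + T * d := by
  set δ := Real.pi / (2 * T) with hδ
  set w := z + u with hw
  have d0 : 0 ≤ d := (norm_nonneg _).trans hd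
  -- For an exactly fixed `w` the state would be `(cos (tδ) w, sin (tδ) w)`. Each step adds a defect
  -- of norm at most `d` and propagates earlier ones isometrically.
  have err : ∀ t : ℕ, √(pairNormSq ((pairStep U δ ^ t) (w, 0) -
      ((Real.cos (t * δ) : ℂ) • w, (Real.sin (t * δ) : ℂ) • w))) ≤ t * d := by
    intro t
    induction t with
    | zero => simp [pairNormSq]
    | succ t ih =>
      set e := (pairStep U δ ^ t) (w, 0) -
        ((Real.cos (t * δ) : ℂ) • w, (Real.sin (t * δ) : ℂ) • w) with he
      have hstep : (pairStep U δ ^ (t + 1)) (w, 0) -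
          ((Real.cos ((t + 1 : ℕ) * δ) : ℂ) • w, (Real.sin ((t + 1 : ℕ) * δ) : ℂ) • w) =
          pairStep U δ e + (0, (Real.sin ((t + 1 : ℕ) * δ) : ℂ) • (U w - w)) := by
        rw [he, map_sub, pow_succ', Module.End.mul_apply, sub_add, sub_right_inj]
        have e1 : ((t + 1 : ℕ) : ℝ) * δ = t * δ + δ := by push_cast; ring
        rw [e1, Real.cos_add, Real.sin_add, pairStep_apply]
        simp only [smul_smul, ← sub_smul, ← add_smul, map_smul, Prod.mk_sub_mk, smul_sub, sub_zero]
        push_cast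
        ext
        · simp only
          congr 1; ring
        · simp only
          rw [← sub_add, mul_comm (Complex.sin δ), mul_comm (Complex.cos δ) (Complex.sin _),
            add_comm (Complex.cos _ * _)]
          simp
      rw [hstep]
      set f := pairStep U δ e
      have hf : √(pairNormSq f) ≤ t * d := by rw [pairNormSq_step]; exact ih
      have hv : ‖(Real.sin ((t + 1 : ℕ) * δ) : ℂ) • (U w - w)‖ ≤ d := by
        rw [norm_smul, Complex.norm_real, Real.norm_eq_abs]
        calc _ ≤ 1 * ‖U w - w‖ := by gcongr; exact Real.abs_sin_le_one _
          _ ≤ d := by simpa using hd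
      set v := (Real.sin ((t + 1 : ℕ) * δ) : ℂ) • (U w - w)
      have hf2 : pairNormSq f ≤ (t * d) ^ 2 := (Real.sqrt_le_left (by positivity)).1 hf
      refine Real.sqrt_le_iff.2 ⟨by positivity, ?_⟩
      have hsnd : ‖f.2‖ ≤ t * d := by
        refine le_of_sq_le_sq ?_ (by positivity)
        refine le_trans ?_ hf2
        simp only [pairNormSq]; nlinarith [sq_nonneg ‖f.1‖]
      simp only [pairNormSq, Prod.fst_add, Prod.snd_add, add_zero] at hf2 ⊢
      have t1 := norm_add_le f.2 v
      have t2 : ‖f.2 + v‖ ^ 2 ≤ (‖f.2‖ + ‖v‖) ^ 2 := by gcongr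
      have t3 : ‖f.2‖ * ‖v‖ ≤ t * d * d := by gcongr
      have t4 : ‖v‖ ^ 2 ≤ d ^ 2 := by gcongr
      push_cast
      nlinarith
  have fst_le : ∀ a : H × H, ‖a.1‖ ≤ √(pairNormSq a) := fun a => by
    refine Real.le_sqrt_of_sq_le ?_
    simp only [pairNormSq]; nlinarith [sq_nonneg ‖a.2‖]
  have hTδ : T * δ = Real.pi / 2 := by rw [hδ]; field_simp
  have h1 := (fst_le _).trans (err T)
  rw [hTδ] at h1
  simp only [Real.cos_pi_div_two, Real.sin_pi_div_two, Prod.fst_sub, Complex.ofReal_zero,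
    zero_smul, sub_zero] at h1
  have h2 : ‖((pairStep U δ ^ T) (u, 0)).1‖ ≤ ‖u‖ := by
    refine (fst_le _).trans ?_
    rw [pairNormSq_step_pow]; simp [pairNormSq]
  have h3 : (z, (0 : H)) = (w, 0) - (u, 0) := by simp [hw]
  rw [h3, map_sub, Prod.fst_sub]
  linarith [norm_sub_le ((pairStep U δ ^ T) (w, 0)).1 ((pairStep U δ ^ T) (u, 0)).1]

end SlowRotation

/-! ### Truncated singular value decomposition -/

section SingularSpace

open Module LinearMap

variable {E F : Type*} [NormedAddCommGroup E] [InnerProductSpace ℂ E] [FiniteDimensional ℂ E]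
  [NormedAddCommGroup F] [InnerProductSpace ℂ F] [FiniteDimensional ℂ F]

/-- An orthonormal basis of right singular vectors, ordered by decreasing singular values. -/
def singularBasis (L : E →ₗ[ℂ] F) : OrthonormalBasis (Fin (finrank ℂ E)) ℂ E :=
  L.isSymmetric_adjoint_comp_self.eigenvectorBasis rfl

/-- The span of the right singular vectors belonging to the `k` largest singular values. -/
def singularSpace (L : E →ₗ[ℂ] F) (k : ℕ) : Submodule ℂ E :=
  Submodule.span ℂ (singularBasis L '' {i | (i : ℕ) < k})

/-- Expand `‖L z‖² = ⟨z, L* L z⟩` in the eigenbasis of `L* L`, whose eigenvalues are the squared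
singular values. -/
lemma norm_apply_sq_eq_sum_singularValues (L : E →ₗ[ℂ] F) (z : E) :
    ‖L z‖ ^ 2 = ∑ i : Fin (finrank ℂ E), L.singularValues i ^ 2 * ‖inner ℂ (singularBasis L i) z‖ ^ 2 := by
  have h1 : ((‖L z‖ ^ 2 : ℝ) : ℂ) = inner ℂ z ((adjoint L ∘ₗ L) z) := by
    rw [LinearMap.comp_apply, LinearMap.adjoint_inner_right, inner_self_eq_norm_sq_to_K]
    norm_cast
  have h2 := (singularBasis L).sum_inner_mul_inner z ((adjoint L ∘ₗ L) z)
  apply Complex.ofReal_injective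
  rw [h1, ← h2, Complex.ofReal_sum]
  refine Finset.sum_congr rfl fun i _ => ?_
  have h3 := L.isSymmetric_adjoint_comp_self.eigenvectorBasis_apply_self_apply rfl z i
  rw [OrthonormalBasis.repr_apply_apply, OrthonormalBasis.repr_apply_apply,
    ← L.sq_singularValues_fin rfl i] at h3
  rw [singularBasis, h3, ← inner_conj_symm z]
  rw [mul_left_comm, Complex.conj_mul', ← Complex.ofReal_pow]
  exact (Complex.ofReal_mul _ _).symm

lemma inner_starProjection_singularSpace (L : E →ₗ[ℂ] F) (k : ℕ) (i : Fin (finrank ℂ E)) (z : E) :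
    inner ℂ (singularBasis L i) ((singularSpace L k).starProjection z) =
      if (i : ℕ) < k then inner ℂ (singularBasis L i) z else 0 := by
  rw [← Submodule.inner_starProjection_left_eq_right]
  split_ifs with h
  · rw [Submodule.starProjection_eq_self_iff.2]
    exact Submodule.subset_span ⟨i, h, rfl⟩
  · rw [(Submodule.starProjection_apply_eq_zero_iff _).2, inner_zero_left]
    rw [Submodule.mem_orthogonal]
    intro u hu
    induction hu using Submodule.span_induction with
    | mem x hx =>
      obtain ⟨j, hj, rfl⟩ := hx
      refine (singularBasis L).orthonormal.2 fun e => h (e ▸ hj)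
    | zero => simp
    | add x y _ _ hx hy => rw [inner_add_left, hx, hy, add_zero]
    | smul a x _ hx => rw [inner_smul_left, hx, mul_zero]

/-- Only the coordinates with index at least `k` survive. Indices start at `0`, so `singularValues
k` is the first one cut off. -/
lemma norm_apply_sub_starProjection_le (L : E →ₗ[ℂ] F) (k : ℕ) (z : E) :
    ‖L (z - (singularSpace L k).starProjection z)‖ ≤ L.singularValues k * ‖z‖ := by
  refine le_of_sq_le_sq ?_ (mul_nonneg (L.singularValues_nonneg k) (norm_nonneg z))
  rw [norm_apply_sq_eq_sum_singularValues, mul_pow, ← (singularBasis L).sum_sq_norm_inner_right z,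
    Finset.mul_sum]
  refine Finset.sum_le_sum fun i _ => ?_
  rw [inner_sub_right, inner_starProjection_singularSpace]
  split_ifs with h
  · rw [sub_self, norm_zero, zero_pow two_ne_zero, mul_zero]; positivity
  · rw [sub_zero]
    gcongr
    · exact L.singularValues_nonneg _
    · exact L.singularValues_antitone (not_lt.1 h)

/-- Every coordinate kept by the projection is stretched by at least the last retained singular
value. For `k = 0` the subtraction truncates, but then the projection vanishes. -/
lemma mul_norm_starProjection_le (L : E →ₗ[ℂ] F) (k : ℕ) (z : E) :
    L.singularValues (k - 1) * ‖(singularSpace L k).starProjection z‖ ≤ ‖L z‖ := by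
  refine le_of_sq_le_sq ?_ (norm_nonneg _)
  rw [norm_apply_sq_eq_sum_singularValues, mul_pow,
    ← (singularBasis L).sum_sq_norm_inner_right ((singularSpace L k).starProjection z),
    Finset.mul_sum]
  refine Finset.sum_le_sum fun i _ => ?_
  rw [inner_starProjection_singularSpace]
  split_ifs with h
  · gcongr
    · exact L.singularValues_nonneg _
    · exact L.singularValues_antitone (by omega)
  · rw [norm_zero, zero_pow two_ne_zero, mul_zero]; positivity

/-- `(1 - P) L*` is the adjoint of `L (1 - P)` and so has the same norm bound. -/
lemma norm_adjoint_sub_starProjection_le (L : E →ₗ[ℂ] F) (k : ℕ) (y : F) :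
    ‖adjoint L y - (singularSpace L k).starProjection (adjoint L y)‖ ≤
      L.singularValues k * ‖y‖ := by
  set P := (singularSpace L k).starProjection
  set w := adjoint L y - P (adjoint L y) with hw
  have hPw : P w = 0 := by
    rw [Submodule.starProjection_apply_eq_zero_iff]
    exact Submodule.sub_starProjection_mem_orthogonal _
  have h1 : inner ℂ w w = inner ℂ y (L w) := by
    nth_rewrite 1 [hw]
    rw [inner_sub_left, Submodule.inner_starProjection_left_eq_right, hPw, inner_zero_right,
      sub_zero, LinearMap.adjoint_inner_left]
  have h2 : ‖L w‖ ≤ L.singularValues k * ‖w‖ := by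
    have := norm_apply_sub_starProjection_le L k w
    rwa [show (singularSpace L k).starProjection w = 0 from hPw, sub_zero] at this
  have h3 : ‖w‖ ^ 2 ≤ L.singularValues k * ‖w‖ * ‖y‖ := by
    have h4 := norm_inner_le_norm (𝕜 := ℂ) y (L w)
    rw [← h1, mul_comm, inner_self_eq_norm_sq_to_K] at h4
    simp only [norm_pow, RCLike.norm_ofReal, abs_norm] at h4
    exact h4.trans (by gcongr)
  rcases (norm_nonneg w).eq_or_lt with h0 | h0
  · rw [← h0]; exact mul_nonneg (L.singularValues_nonneg k) (norm_nonneg y)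
  · nlinarith

end SingularSpace

/-! ### Truncating the matrix of the `ψ_x` -/

variable {n m : ℕ} {X : Finset (Fin n → Bool)}

/-- Entrywise complex conjugation. -/
def conjVec {ι : Type*} (z : EuclideanSpace ℂ ι) : EuclideanSpace ℂ ι :=
  WithLp.toLp 2 fun k => star (z k)

lemma conjVec_apply {ι : Type*} (z : EuclideanSpace ℂ ι) (k : ι) :
    conjVec z k = star (z k) := rfl

/-- The right singular space of the matrix of the `ψ_x`: it almost contains every conjugate of a
`ψ_x`, and it is almost orthogonal to every conjugate of a `φ_y`. -/
lemma singularSpace_psiMatrix (c : ℝ) (f : X → Bool) (v : X → Fin n → EuclideanSpace ℂ (Fin m))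
    (k : ℕ) :
    ∃ V : Submodule ℂ (EuclideanSpace ℂ (HBasis n m)),
      (∀ x, f x = true → ‖conjVec (psi c v x) - V.starProjection (conjVec (psi c v x))‖ ≤
        singVal (psiMatrix c f v) (k + 1)) ∧
      ∀ y, f y = false → singVal (psiMatrix c f v) k * ‖V.starProjection (conjVec (phi c v y))‖ ≤
        √(Fintype.card {x : X // f x = true} : ℝ) * crossError c f v := by
  classical
  set L := Matrix.toEuclideanLin (psiMatrix c f v) with hL
  refine ⟨singularSpace L k, fun x hx => ?_, fun y hy => ?_⟩
  · have h := norm_adjoint_sub_starProjection_le L k (EuclideanSpace.single ⟨x, hx⟩ 1)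
    -- The rows of `M` are not conjugated, so `(M z)_x` is the inner product of `conj ψ_x` with `z`.
    -- This is why conjugates appear throughout.
    have e : LinearMap.adjoint L (EuclideanSpace.single ⟨x, hx⟩ 1) = conjVec (psi c v x) := by
      rw [hL, ← Matrix.toEuclideanLin_conjTranspose_eq_adjoint]
      ext j
      simp [Matrix.toLpLin_apply, psiMatrix, conjVec_apply]
    rw [e] at h
    simpa [singVal] using h
  · refine (mul_norm_starProjection_le L k _).trans ?_
    have bound : ∀ x : {x : X // f x = true}, ‖L (conjVec (phi c v y)) x‖ ≤ crossError c f v := by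
      intro x
      have e : L (conjVec (phi c v y)) x = inner ℂ (phi c v y) (psi c v x.1) := by
        simp [hL, Matrix.toLpLin_apply, psiMatrix, Matrix.mulVec, dotProduct,
          PiLp.inner_apply, conjVec_apply]
      rw [e, norm_inner_symm]
      exact le_ciSup (f := fun p : {x : X // f x = true} × {y : X // f y = false} =>
        ‖inner ℂ (psi c v p.1.1) (phi c v p.2.1)‖) (Set.finite_range _).bddAbove (x, ⟨y, hy⟩)
    have e0 : 0 ≤ crossError c f v := Real.iSup_nonneg fun _ => norm_nonneg _
    rw [EuclideanSpace.norm_eq]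
    refine Real.sqrt_le_iff.2 ⟨by positivity, ?_⟩
    rw [mul_pow, Real.sq_sqrt (by positivity)]
    calc _ ≤ ∑ _x : {x : X // f x = true}, crossError c f v ^ 2 :=
          Finset.sum_le_sum fun x _ => by gcongr; exact bound x
      _ = _ := by simp

/-! ### The query algorithm that detects fixed vectors -/

/-- Computational basis of the space the walk acts on: query index, query bit, and either the
label of a basis vector of `ℂᵐ` or `none`, which marks the sector of `0̂`. -/
abbrev WalkBasis (n m : ℕ) : Type := Fin n × Bool × Option (Fin m)

/-- The workspace holds the control qubit and the `Option (Fin m)` register. -/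
def workEquiv (m : ℕ) : Bool × Option (Fin m) ≃ Fin (2 * (m + 1)) :=
  Fintype.equivFinOfCardEq (by simp)

/-- Splits off the control qubit. -/
def controlEquiv (n m : ℕ) : Bool × WalkBasis n m ≃ Basis n (2 * (m + 1)) where
  toFun p := (p.2.1, p.2.2.1, workEquiv m (p.1, p.2.2.2))
  invFun q := (((workEquiv m).symm q.2.2).1, q.1, q.2.1, ((workEquiv m).symm q.2.2).2)
  left_inv p := by simp
  right_inv q := by simp

/-- The state `|0⟩p + |1⟩q` of the algorithm. -/
def pairEquiv (n m : ℕ) :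
    (EuclideanSpace ℂ (WalkBasis n m) × EuclideanSpace ℂ (WalkBasis n m)) ≃ₗ[ℂ]
      EuclideanSpace ℂ (Basis n (2 * (m + 1))) where
  toFun z := WithLp.toLp 2 fun p =>
    bif ((controlEquiv n m).symm p).1 then z.2 ((controlEquiv n m).symm p).2
    else z.1 ((controlEquiv n m).symm p).2
  invFun y := (WithLp.toLp 2 fun k => y (controlEquiv n m (false, k)),
    WithLp.toLp 2 fun k => y (controlEquiv n m (true, k)))
  map_add' y z := by
    ext p
    cases h : ((controlEquiv n m).symm p).1 <;> simp [h]
  map_smul' r z := by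
    ext p
    cases h : ((controlEquiv n m).symm p).1 <;> simp [h]
  left_inv z := by simp
  right_inv y := by
    ext p
    obtain ⟨⟨b, k⟩, rfl⟩ := (controlEquiv n m).surjective p
    cases b <;> simp

lemma pairEquiv_controlEquiv
    (z : EuclideanSpace ℂ (WalkBasis n m) × EuclideanSpace ℂ (WalkBasis n m)) (b : Bool)
    (k : WalkBasis n m) :
    pairEquiv n m z (controlEquiv n m (b, k)) = bif b then z.2 k else z.1 k := by
  simp [pairEquiv]

lemma norm_pairEquiv_sq
    (z : EuclideanSpace ℂ (WalkBasis n m) × EuclideanSpace ℂ (WalkBasis n m)) :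
    ‖pairEquiv n m z‖ ^ 2 = pairNormSq z := by
  rw [EuclideanSpace.norm_sq_eq, ← (controlEquiv n m).sum_comp, Fintype.sum_prod_type]
  simp only [pairEquiv_controlEquiv, pairNormSq, EuclideanSpace.norm_sq_eq, Fintype.sum_bool,
    cond_true, cond_false]
  rw [add_comm]

/-- A unitary given by its action on `|0⟩p + |1⟩q`. -/
def pairUnitary
    (A : Module.End ℂ (EuclideanSpace ℂ (WalkBasis n m) × EuclideanSpace ℂ (WalkBasis n m)))
    (hA : ∀ z, pairNormSq (A z) = pairNormSq z) :
    EuclideanSpace ℂ (Basis n (2 * (m + 1))) ≃ₗᵢ[ℂ] EuclideanSpace ℂ (Basis n (2 * (m + 1))) :=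
  LinearIsometry.toLinearIsometryEquiv
    { toLinearMap := (pairEquiv n m).toLinearMap ∘ₗ A ∘ₗ (pairEquiv n m).symm.toLinearMap
      norm_map' := fun y => by
        obtain ⟨z, rfl⟩ := (pairEquiv n m).surjective y
        rw [← sq_eq_sq₀ (norm_nonneg _) (norm_nonneg _)]
        simp [norm_pairEquiv_sq, hA] } rfl

lemma pairUnitary_pairEquiv
    (A : Module.End ℂ (EuclideanSpace ℂ (WalkBasis n m) × EuclideanSpace ℂ (WalkBasis n m)))
    (hA : ∀ z, pairNormSq (A z) = pairNormSq z) (z) :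
    pairUnitary A hA (pairEquiv n m z) = pairEquiv n m (A z) := by
  simp [pairUnitary]

/-- The oracle on the space of the walk. -/
def walkOracle (m : ℕ) (x : Fin n → Bool) :
    EuclideanSpace ℂ (WalkBasis n m) ≃ₗᵢ[ℂ] EuclideanSpace ℂ (WalkBasis n m) :=
  LinearIsometryEquiv.piLpCongrLeft 2 ℂ ℂ
    { toFun := fun p => (p.1, xor p.2.1 (x p.1), p.2.2)
      invFun := fun p => (p.1, xor p.2.1 (x p.1), p.2.2)
      left_inv := fun p => by simp
      right_inv := fun p => by simp }

lemma walkOracle_apply (x : Fin n → Bool) (z : EuclideanSpace ℂ (WalkBasis n m)) (i b o) :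
    walkOracle m x z (i, b, o) = z (i, xor b (x i), o) := rfl

/-- The oracle acts regardless of the control qubit, hence in both branches; no controlled query is
available. -/
lemma oracle_pairEquiv (x : Fin n → Bool)
    (z : EuclideanSpace ℂ (WalkBasis n m) × EuclideanSpace ℂ (WalkBasis n m)) :
    oracle (2 * (m + 1)) x (pairEquiv n m z) = pairEquiv n m (pairDiag (walkOracle m x) z) := by
  ext p
  obtain ⟨⟨a, i, b, o⟩, rfl⟩ := (controlEquiv n m).surjective p
  have e : oracle (2 * (m + 1)) x (pairEquiv n m z) (controlEquiv n m (a, i, b, o)) =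
      pairEquiv n m z (controlEquiv n m (a, i, xor b (x i), o)) := rfl
  rw [e, pairEquiv_controlEquiv, pairEquiv_controlEquiv]
  rfl

/-- Changes the sign of the basis vectors with query bit `1` outside the sector of `0̂`. -/
def walkSign (n m : ℕ) :
    EuclideanSpace ℂ (WalkBasis n m) ≃ₗᵢ[ℂ] EuclideanSpace ℂ (WalkBasis n m) :=
  LinearIsometryEquiv.piLpCongrRight 2 fun k =>
    if k.2.1 = true ∧ k.2.2.isSome = true then LinearIsometryEquiv.neg ℂ
    else LinearIsometryEquiv.refl ℂ ℂ

lemma walkSign_apply (z : EuclideanSpace ℂ (WalkBasis n m)) (k) :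
    walkSign n m z k = if k.2.1 = true ∧ k.2.2.isSome = true then -z k else z k := by
  simp only [walkSign, LinearIsometryEquiv.piLpCongrRight_apply]
  split_ifs <;> simp

/-- The reflection about the span of `|0̂⟩` and the `|i⟩|·⟩|x_i⟩`. -/
def inputReflection (m : ℕ) (x : Fin n → Bool) :
    EuclideanSpace ℂ (WalkBasis n m) ≃ₗᵢ[ℂ] EuclideanSpace ℂ (WalkBasis n m) :=
  ((walkOracle m x).trans (walkSign n m)).trans (walkOracle m x)

lemma inputReflection_apply (x : Fin n → Bool) (z : EuclideanSpace ℂ (WalkBasis n m)) (i b o) :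
    inputReflection m x z (i, b, o) =
      if b ≠ x i ∧ o.isSome = true then -z (i, b, o) else z (i, b, o) := by
  simp only [inputReflection, LinearIsometryEquiv.trans_apply, walkOracle_apply, walkSign_apply]
  cases b <;> cases x i <;> simp

/-- The product of the two reflections. -/
def walk (V : Submodule ℂ (EuclideanSpace ℂ (WalkBasis n m))) (x : Fin n → Bool) :
    EuclideanSpace ℂ (WalkBasis n m) ≃ₗᵢ[ℂ] EuclideanSpace ℂ (WalkBasis n m) :=
  (inputReflection m x).trans V.reflection

/-- The unitaries of the algorithm `detector`. -/
def detectorUnitary (V : Submodule ℂ (EuclideanSpace ℂ (WalkBasis n m))) (T t : ℕ) :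
    EuclideanSpace ℂ (Basis n (2 * (m + 1))) ≃ₗᵢ[ℂ] EuclideanSpace ℂ (Basis n (2 * (m + 1))) :=
  if t = 0 then LinearIsometryEquiv.refl ℂ _
  else if Even t then pairUnitary (pairControl V.reflection) (pairNormSq_control _)
  else pairUnitary (pairStep (walkSign n m) (Real.pi / (2 * T))) (pairNormSq_step _ _)

/-- The algorithm that performs `T` slowly rotating controlled steps of the walk and then measures
the control qubit. -/
def detector (i₀ : Fin n) (V : Submodule ℂ (EuclideanSpace ℂ (WalkBasis n m))) (T : ℕ) :
    QueryAlgorithm n where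
  queries := 2 * T
  work := 2 * (m + 1)
  U := detectorUnitary V T
  init := controlEquiv n m (false, i₀, false, none)
  output p := ((controlEquiv n m).symm p).1

/-- Controlling only the sign change between the two queries is enough: in the branch `|0⟩` the
queries cancel. The rotation of the control commutes with the query, so it can be merged into the
middle unitary. -/
lemma two_queries_pairEquiv (V : Submodule ℂ (EuclideanSpace ℂ (WalkBasis n m))) (T t : ℕ)
    (x : Fin n → Bool) (w) :
    detectorUnitary V T (2 * t + 2) (oracle (2 * (m + 1)) x
      (detectorUnitary V T (2 * t + 1) (oracle (2 * (m + 1)) x (pairEquiv n m w)))) =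
      pairEquiv n m (pairStep (walk V x) (Real.pi / (2 * T)) w) := by
  have u2 : detectorUnitary V T (2 * t + 2) =
      pairUnitary (pairControl V.reflection) (pairNormSq_control _) := by
    rw [detectorUnitary, if_neg (by omega), if_pos ⟨t + 1, by ring⟩]
  have u1 : detectorUnitary V T (2 * t + 1) =
      pairUnitary (pairStep (walkSign n m) (Real.pi / (2 * T))) (pairNormSq_step _ _) := by
    rw [detectorUnitary, if_neg (by omega), if_neg (by simp)]
  have inv : ∀ z, walkOracle m x (walkOracle m x z) = z := fun z => by
    ext ⟨i, b, o⟩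
    simp [walkOracle_apply]
  rw [u1, u2, oracle_pairEquiv, pairUnitary_pairEquiv, oracle_pairEquiv, pairUnitary_pairEquiv]
  congr 1
  simp only [pairStep_apply, pairDiag_apply, pairControl_apply, map_sub, map_add, map_smul, walk,
    inputReflection, LinearIsometryEquiv.trans_apply, inv]

lemma detector_state (i₀ : Fin n) (V : Submodule ℂ (EuclideanSpace ℂ (WalkBasis n m))) (T : ℕ)
    (x : Fin n → Bool) (t : ℕ) :
    (detector i₀ V T).state x (2 * t) = pairEquiv n m
      ((pairStep (walk V x) (Real.pi / (2 * T)) ^ t)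
        (EuclideanSpace.single (i₀, false, none) 1, 0)) := by
  induction t with
  | zero =>
    have h : (detector i₀ V T).state x (2 * 0) = detectorUnitary V T 0
      (EuclideanSpace.single (controlEquiv n m (false, i₀, false, none)) 1) := rfl
    rw [h, detectorUnitary, if_pos rfl, pow_zero, Module.End.one_apply]
    ext p
    obtain ⟨⟨a, k⟩, rfl⟩ := (controlEquiv n m).surjective p
    rw [pairEquiv_controlEquiv]
    cases a <;> simp [PiLp.single_apply]
  | succ t ih =>
    rw [pow_succ', Module.End.mul_apply, ← two_queries_pairEquiv V T t, ← ih]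
    rfl

lemma detector_prob (i₀ : Fin n) (V : Submodule ℂ (EuclideanSpace ℂ (WalkBasis n m))) (T : ℕ)
    (x : Fin n → Bool) (b : Bool) :
    (detector i₀ V T).prob x b =
      1 - ‖bif b then ((pairStep (walk V x) (Real.pi / (2 * T)) ^ T)
          (EuclideanSpace.single (i₀, false, none) 1, 0)).1
        else ((pairStep (walk V x) (Real.pi / (2 * T)) ^ T)
          (EuclideanSpace.single (i₀, false, none) 1, 0)).2‖ ^ 2 := by
  set w := (pairStep (walk V x) (Real.pi / (2 * T)) ^ T)
    (EuclideanSpace.single (i₀, false, none) 1, 0) with hw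
  have hN : pairNormSq w = 1 := by
    rw [hw, pairNormSq_step_pow]; simp [pairNormSq]
  have h : (detector i₀ V T).prob x b =
      ∑ p : Basis n (2 * (m + 1)) with ((controlEquiv n m).symm p).1 = b,
        ‖(detector i₀ V T).state x (2 * T) p‖ ^ 2 := rfl
  rw [h, detector_state, ← hw, Finset.sum_filter, ← (controlEquiv n m).sum_comp,
    Fintype.sum_prod_type]
  simp only [pairNormSq, EuclideanSpace.norm_sq_eq] at hN
  cases b <;> simp [pairEquiv_controlEquiv, EuclideanSpace.norm_sq_eq] at hN ⊢ <;>
    linarith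

/-! ### The algorithm built from a vector set -/

/-- The embedding of `ℂ ⊕ ℂⁿ ⊗ ℂᵐ ⊗ ℂ²` into the space of the walk. -/
def walkEmbed (m : ℕ) (i₀ : Fin n) :
    EuclideanSpace ℂ (HBasis n m) →ₗᵢ[ℂ] EuclideanSpace ℂ (WalkBasis n m) where
  toFun z := WithLp.toLp 2 fun p =>
    p.2.2.elim (if p.1 = i₀ ∧ p.2.1 = false then z (Sum.inl ()) else 0)
      fun k => z (Sum.inr (p.1, k, p.2.1))
  map_add' y z := by
    ext ⟨i, b, o⟩
    cases o with
    | none => by_cases h : i = i₀ ∧ b = false <;> simp [h]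
    | some k => simp
  map_smul' r z := by
    ext ⟨i, b, o⟩
    cases o <;> simp
  norm_map' z := by
    rw [← sq_eq_sq₀ (norm_nonneg _) (norm_nonneg _)]
    simp only [LinearMap.coe_mk, AddHom.coe_mk, EuclideanSpace.norm_sq_eq, Fintype.sum_sum_type,
      Fintype.sum_prod_type, Fintype.sum_option, Option.elim_none, Option.elim_some,
      Fintype.sum_bool, Finset.univ_unique, Finset.sum_singleton]
    simp only [Finset.sum_add_distrib, apply_ite, norm_zero, ite_pow]
    simp only [Bool.true_eq_false, and_false, if_false, and_true, ne_eq, OfNat.ofNat_ne_zero,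
      not_false_eq_true, zero_pow, Finset.sum_ite_eq', Finset.mem_univ, if_true,
      Finset.sum_const_zero, zero_add]
    rw [add_left_comm]

lemma walkEmbed_apply_none (i₀ : Fin n) (z : EuclideanSpace ℂ (HBasis n m)) (i b) :
    walkEmbed m i₀ z (i, b, none) = if i = i₀ ∧ b = false then z (Sum.inl ()) else 0 := rfl

lemma walkEmbed_apply_some (i₀ : Fin n) (z : EuclideanSpace ℂ (HBasis n m)) (i b k) :
    walkEmbed m i₀ z (i, b, some k) = z (Sum.inr (i, k, b)) := rfl

lemma walkEmbed_single (i₀ : Fin n) :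
    walkEmbed m i₀ (EuclideanSpace.single (Sum.inl ()) 1) =
      EuclideanSpace.single (i₀, false, none) 1 := by
  ext ⟨i, b, o⟩
  cases o <;> simp [walkEmbed_apply_none, walkEmbed_apply_some, PiLp.single_apply]

lemma conjVec_combine_apply_inl (a : ℂ) (v : Fin n → EuclideanSpace ℂ (Fin m)) (z : Fin n → Bool) :
    conjVec (combine a v z) (Sum.inl ()) = 1 := by
  simp [conjVec_apply, combine]

lemma conjVec_combine_apply_inr (a : ℂ) (v : Fin n → EuclideanSpace ℂ (Fin m)) (z : Fin n → Bool)
    (i k b) :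
    conjVec (combine a v z) (Sum.inr (i, k, b)) = if b = z i then star (a * v i k) else 0 := by
  simp only [conjVec_apply, combine, Sum.elim_inr]
  split_ifs <;> simp

lemma conjVec_real_smul {ι : Type*} (r : ℝ) (z : EuclideanSpace ℂ ι) :
    conjVec ((r : ℂ) • z) = (r : ℂ) • conjVec z := by
  ext k
  simp [conjVec_apply]

lemma norm_conjVec_combine_sub_sq (a : ℂ) (v : Fin n → EuclideanSpace ℂ (Fin m))
    (z : Fin n → Bool) :
    ‖conjVec (combine a v z) - EuclideanSpace.single (Sum.inl ()) 1‖ ^ 2 =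
      ‖a‖ ^ 2 * ∑ i, ‖v i‖ ^ 2 := by
  simp only [EuclideanSpace.norm_sq_eq, Fintype.sum_sum_type, Fintype.sum_prod_type,
    PiLp.sub_apply, conjVec_combine_apply_inr, Finset.univ_unique, Finset.sum_singleton,
    PiLp.single_apply, Finset.mul_sum]
  simp [conjVec_combine_apply_inl, apply_ite, ite_pow, mul_pow]

lemma norm_conjVec_combine_sq (a : ℂ) (v : Fin n → EuclideanSpace ℂ (Fin m)) (z : Fin n → Bool) :
    ‖conjVec (combine a v z)‖ ^ 2 = 1 + ‖a‖ ^ 2 * ∑ i, ‖v i‖ ^ 2 := by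
  simp only [EuclideanSpace.norm_sq_eq, Fintype.sum_sum_type, Fintype.sum_prod_type,
    conjVec_combine_apply_inr, Finset.univ_unique, Finset.sum_singleton, Finset.mul_sum]
  simp [conjVec_combine_apply_inl, apply_ite, ite_pow, mul_pow]

/-- Apart from `0̂`, the vector lives on query bits equal to `x i`, where the reflection acts
trivially. -/
lemma inputReflection_walkEmbed_same (i₀ : Fin n) (a : ℂ) (v : Fin n → EuclideanSpace ℂ (Fin m))
    (x : Fin n → Bool) :
    inputReflection m x (walkEmbed m i₀ (conjVec (combine a v x))) =
      walkEmbed m i₀ (conjVec (combine a v x)) := by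
  ext ⟨i, b, o⟩
  rw [inputReflection_apply]
  cases o with
  | none => simp
  | some k =>
    by_cases h : b = x i <;> simp [h, walkEmbed_apply_some, conjVec_combine_apply_inr]

/-- Here everything except the component `|0̂⟩` is on the wrong query bits and is negated. -/
lemma inputReflection_walkEmbed_not (i₀ : Fin n) (a : ℂ) (v : Fin n → EuclideanSpace ℂ (Fin m))
    (x : Fin n → Bool) :
    inputReflection m x (walkEmbed m i₀ (conjVec (combine a v fun i => !x i))) =
      (2 : ℂ) • EuclideanSpace.single (i₀, false, none) 1 -
        walkEmbed m i₀ (conjVec (combine a v fun i => !x i)) := by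
  ext ⟨i, b, o⟩
  rw [inputReflection_apply, ← walkEmbed_single]
  cases o with
  | none =>
    by_cases h : i = i₀ ∧ b = false
    · simp only [walkEmbed_apply_none, h, PiLp.sub_apply, PiLp.smul_apply,
        conjVec_combine_apply_inl]
      norm_num
    · simp [walkEmbed_apply_none, h]
  | some k =>
    cases b <;> cases h : x i <;>
      simp [h, walkEmbed_apply_some, conjVec_combine_apply_inr]

lemma inputReflection_single (i₀ : Fin n) (x : Fin n → Bool) :
    inputReflection m x (EuclideanSpace.single (i₀, false, none) 1) =
      EuclideanSpace.single (i₀, false, none) 1 := by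
  ext ⟨i, b, o⟩
  rw [inputReflection_apply]
  cases o <;> simp [PiLp.single_apply]

/-- Acceptance: the conjugate of the unnormalized `ψ_x` is almost fixed by the walk. -/
lemma norm_fst_walk_le (i₀ : Fin n) (V : Submodule ℂ (EuclideanSpace ℂ (HBasis n m))) (T : ℕ)
    (hT : T ≠ 0) (a : ℂ) (v : Fin n → EuclideanSpace ℂ (Fin m)) (x : Fin n → Bool) :
    ‖((pairStep (walk (V.map (walkEmbed m i₀).toLinearMap) x) (Real.pi / (2 * T)) ^ T)
        (EuclideanSpace.single (i₀, false, none) 1, 0)).1‖ ≤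
      ‖conjVec (combine a v x) - EuclideanSpace.single (Sum.inl ()) 1‖ +
        T * (2 * ‖conjVec (combine a v x) - V.starProjection (conjVec (combine a v x))‖) := by
  set g := conjVec (combine a v x) with hg
  have h := norm_fst_step_pow_le (walk (V.map (walkEmbed m i₀).toLinearMap) x) T hT
    (z := EuclideanSpace.single (i₀, false, none) 1)
    (u := walkEmbed m i₀ (g - EuclideanSpace.single (Sum.inl ()) 1))
    (d := 2 * ‖g - V.starProjection g‖) ?_
  · rwa [LinearIsometry.norm_map] at h
  · rw [← walkEmbed_single, ← map_add, add_sub_cancel, walk, LinearIsometryEquiv.trans_apply, hg,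
      inputReflection_walkEmbed_same, Submodule.reflection_apply,
      ← LinearIsometry.map_starProjection, ← hg, ← map_nsmul, ← map_sub, ← map_sub,
      LinearIsometry.norm_map]
    have e : 2 • V.starProjection g - g - g = -((2 : ℂ) • (g - V.starProjection g)) := by
      module
    rw [e, norm_neg, norm_smul, Complex.norm_ofNat]

/-- Rejection: the conjugate of the unnormalized `φ_x` is almost orthogonal to `V`. -/
lemma norm_snd_walk_le (i₀ : Fin n) (V : Submodule ℂ (EuclideanSpace ℂ (HBasis n m))) (T : ℕ)
    {δ : ℝ} (hδ : Real.sin δ ≠ 0) (a : ℂ) (v : Fin n → EuclideanSpace ℂ (Fin m))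
    (x : Fin n → Bool) :
    Real.cos δ ^ 2 * ‖((pairStep (walk (V.map (walkEmbed m i₀).toLinearMap) x) δ ^ T)
        (EuclideanSpace.single (i₀, false, none) 1, 0)).2‖ ^ 2 ≤
      Real.sin δ ^ 2 * ‖conjVec (combine a v fun i => !x i)‖ ^ 2 +
        Real.cos δ ^ 2 * ‖V.starProjection (conjVec (combine a v fun i => !x i))‖ ^ 2 := by
  set g := conjVec (combine a v fun i => !x i) with hg
  -- With `R_V` the reflection about the embedded `V`, `U g = R_V (2|0̂⟩ - g) = 2 U|0̂⟩ + g - 2 P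
  -- g`, so the error vector is `η = P g`.
  have h := norm_snd_step_pow_le (walk (V.map (walkEmbed m i₀).toLinearMap) x) δ hδ T
    (z := EuclideanSpace.single (i₀, false, none) 1) (g := walkEmbed m i₀ g)
    (η := walkEmbed m i₀ (V.starProjection g)) ?_
  · rwa [LinearIsometry.norm_map, LinearIsometry.norm_map] at h
  · simp only [walk, LinearIsometryEquiv.trans_apply, hg, inputReflection_walkEmbed_not,
      inputReflection_single]
    rw [← hg, map_sub, map_smul, Submodule.reflection_apply (walkEmbed m i₀ g),
      ← LinearIsometry.map_starProjection]
    module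

/-! ### Numerical estimates for the success probability -/

lemma weight_nonneg (v : X → Fin n → EuclideanSpace ℂ (Fin m)) (x : X) : 0 ≤ weight v x :=
  Finset.sum_nonneg fun _ _ => sq_nonneg _

lemma weight_le_size (v : X → Fin n → EuclideanSpace ℂ (Fin m)) (x : X) : weight v x ≤ size v :=
  le_ciSup (Set.finite_range _).bddAbove x

lemma conjVec_combine_eq_psi {c : ℝ} {v : X → Fin n → EuclideanSpace ℂ (Fin m)} {x : X}
    (h : 0 < nu c v x) :
    conjVec (combine ((1 / √(c * size v) : ℝ) : ℂ) (v x) x) =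
      ((√(nu c v x) : ℝ) : ℂ) • conjVec (psi c v x) := by
  rw [psi, conjVec_real_smul, smul_smul, ← Complex.ofReal_mul,
    mul_one_div_cancel (Real.sqrt_ne_zero'.2 h), Complex.ofReal_one, one_smul]

lemma conjVec_combine_eq_phi {c : ℝ} {v : X → Fin n → EuclideanSpace ℂ (Fin m)} {x : X}
    (h : 0 < mu c v x) :
    conjVec (combine (-((√(c * size v) : ℝ) : ℂ)) (v x) fun i => !(x : Fin n → Bool) i) =
      ((√(mu c v x) : ℝ) : ℂ) • conjVec (phi c v x) := by
  rw [phi, conjVec_real_smul, smul_smul, ← Complex.ofReal_mul,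
    mul_one_div_cancel (Real.sqrt_ne_zero'.2 h), Complex.ofReal_one, one_smul]

/-- The number of steps of the walk. -/
def walkSteps (c A : ℝ) : ℕ := ⌈8 * (√c * A)⌉₊

lemma ten_le_sqrt_mul {c A : ℝ} (hc : 100 ≤ c) (hA : 1 ≤ A) : 10 ≤ √c * A := by
  have : (10 : ℝ) ≤ √c := Real.le_sqrt_of_sq_le (by linarith)
  nlinarith

lemma le_walkSteps (c A : ℝ) : 8 * (√c * A) ≤ walkSteps c A := Nat.le_ceil _

lemma walkSteps_le {c A : ℝ} (hc : 100 ≤ c) (hA : 1 ≤ A) :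
    (walkSteps c A : ℝ) ≤ 81 / 10 * (√c * A) := by
  have h := ten_le_sqrt_mul hc hA
  have := (Nat.ceil_lt_add_one (a := 8 * (√c * A)) (by linarith)).le
  rw [walkSteps]; linarith

/-- The failure amplitude is at most `1/10` (distance of the unnormalized `ψ_x` from `|0̂⟩`) plus
`3/10` (drift over all steps), and `(4/10)² ≤ 1/3`. -/
lemma two_thirds_le_prob_true {c : ℝ} (hc : 100 ≤ c) {v : X → Fin n → EuclideanSpace ℂ (Fin m)}
    (hA : 1 ≤ size v) (i₀ : Fin n) (V : Submodule ℂ (EuclideanSpace ℂ (HBasis n m))) (x : X)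
    (hV : ‖conjVec (psi c v x) - V.starProjection (conjVec (psi c v x))‖ ≤
      1 / (2 * √(1000 * c) * size v)) :
    2 / 3 ≤ (detector i₀ (V.map (walkEmbed m i₀).toLinearMap) (walkSteps c (size v))).prob x
      true := by
  set A := size v with hAdef
  have hr := ten_le_sqrt_mul hc hA
  have hT := walkSteps_le hc hA
  have hT0 : walkSteps c A ≠ 0 := by
    have := le_walkSteps c A
    intro h
    rw [h] at this
    norm_num at this; linarith
  have hw0 := weight_nonneg v x
  have hw := weight_le_size v x
  have hq : 1 / (c * A) * weight v x ≤ 1 / 100 := by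
    rw [one_div_mul_eq_div, div_le_iff₀ (by positivity)]; nlinarith
  have hν0 : 0 ≤ 1 / (c * A) * weight v x := by positivity
  have hν : nu c v x ≤ (101 / 100) ^ 2 := by rw [nu]; norm_num at hq ⊢; linarith
  have hsν : √(nu c v x) ≤ 101 / 100 := Real.sqrt_le_iff.2 ⟨by norm_num, hν⟩
  have h := norm_fst_walk_le i₀ V (walkSteps c A) hT0 ((1 / √(c * A) : ℝ) : ℂ) (v x) x
  have hu : ‖conjVec (combine ((1 / √(c * A) : ℝ) : ℂ) (v x) (x : Fin n → Bool)) -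
      EuclideanSpace.single (Sum.inl ()) 1‖ ≤ 1 / 10 := by
    refine le_of_sq_le_sq ?_ (by norm_num)
    rw [norm_conjVec_combine_sub_sq, Complex.norm_real, Real.norm_eq_abs, sq_abs, div_pow, one_pow,
      Real.sq_sqrt (by positivity)]
    change 1 / (c * A) * weight v x ≤ _
    norm_num at hq ⊢; linarith
  rw [conjVec_combine_eq_psi (by rw [nu]; linarith)] at h hu
  rw [map_smul, ← smul_sub, norm_smul (_ : ℂ) (_ - V.starProjection _), Complex.norm_real,
    Real.norm_of_nonneg (Real.sqrt_nonneg _)] at h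
  -- Uses `√1000 ≥ 31`.
  have hσ : 1 / (2 * √(1000 * c) * A) ≤ 1 / (62 * (√c * A)) := by
    have h31 : (31 : ℝ) ≤ √1000 := Real.le_sqrt_of_sq_le (by norm_num)
    rw [Real.sqrt_mul (by norm_num)]
    apply one_div_le_one_div_of_le (by positivity)
    nlinarith
  have hprod : (walkSteps c A : ℝ) * (2 * (√(nu c v x) *
      ‖conjVec (psi c v x) - V.starProjection (conjVec (psi c v x))‖)) ≤ 3 / 10 := by
    calc _ ≤ 81 / 10 * (√c * A) * (2 * (101 / 100 * (1 / (62 * (√c * A))))) := by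
          gcongr; exact hV.trans hσ
      _ = 81 / 10 * 2 * (101 / 100) / 62 := by field_simp
      _ ≤ _ := by norm_num
  rw [detector_prob, cond_true]
  have h4 := h.trans (add_le_add hu hprod)
  have h5 := pow_le_pow_left₀ (norm_nonneg _) h4 2
  norm_num at h5 ⊢
  linarith

/-- With `r = √c A ≥ 10`, the two squared errors are at most `0.041` and `101/400`; their sum stays
below `cos² δ / 3`. -/
lemma two_thirds_le_prob_false {c : ℝ} (hc : 100 ≤ c) {v : X → Fin n → EuclideanSpace ℂ (Fin m)}
    (hA : 1 ≤ size v) (i₀ : Fin n) (V : Submodule ℂ (EuclideanSpace ℂ (HBasis n m))) (x : X)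
    (hV : ‖V.starProjection (conjVec (phi c v x))‖ ≤ 1 / (2 * √c * size v)) :
    2 / 3 ≤ (detector i₀ (V.map (walkEmbed m i₀).toLinearMap) (walkSteps c (size v))).prob x
      false := by
  set A := size v with hAdef
  have hr := ten_le_sqrt_mul hc hA
  have hT := le_walkSteps c A
  set T := walkSteps c A
  set r := √c * A with hrdef
  set δ := Real.pi / (2 * T) with hδ
  have hTpos : (0 : ℝ) < T := by linarith
  have hδ0 : 0 < δ := by positivity
  -- The factor `8` in `walkSteps` gives `δ r ≤ π / 16`.
  have hδr : δ * r ≤ 1 / 5 := by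
    rw [hδ, div_mul_eq_mul_div, div_le_iff₀ (by positivity)]
    nlinarith [Real.pi_lt_d2]
  have hδ1 : δ ≤ 1 / 50 := by nlinarith
  have hsin : 0 < Real.sin δ := Real.sin_pos_of_pos_of_lt_pi hδ0 (by linarith [Real.pi_gt_three])
  have hsin2 : Real.sin δ ^ 2 ≤ δ ^ 2 := by
    have := Real.sin_le hδ0.le
    gcongr
  have hcos := Real.sin_sq_add_cos_sq δ
  have hw0 := weight_nonneg v x
  have hw := weight_le_size v x
  have hr2 : r ^ 2 = c * A * A := by rw [hrdef, mul_pow, Real.sq_sqrt (by linarith)]; ring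
  have hμ : mu c v x ≤ 1 + r ^ 2 := by
    rw [mu, hr2]
    gcongr
  have hμ0 : 0 < mu c v x := by rw [mu]; positivity
  have h := norm_snd_walk_le i₀ V T hsin.ne' (-((√(c * A) : ℝ) : ℂ)) (v x) x
  rw [norm_conjVec_combine_sq, conjVec_combine_eq_phi hμ0, map_smul, norm_smul, norm_neg,
    Complex.norm_real, Complex.norm_real, Real.norm_eq_abs, Real.norm_eq_abs, sq_abs, mul_pow,
    sq_abs, Real.sq_sqrt (by positivity), Real.sq_sqrt hμ0.le] at h
  change _ ≤ Real.sin δ ^ 2 * mu c v x + _ at h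
  have hη : mu c v x * ‖V.starProjection (conjVec (phi c v x))‖ ^ 2 ≤ 101 / 400 := by
    have e : 1 / (2 * √c * A) = 1 / (2 * r) := by rw [hrdef, mul_assoc]
    calc _ ≤ (1 + r ^ 2) * (1 / (2 * r)) ^ 2 := by rw [← e]; gcongr
      _ = (1 + r ^ 2) / (4 * r ^ 2) := by ring
      _ ≤ _ := by
        rw [div_le_iff₀ (by positivity)]
        nlinarith
  have hs : Real.sin δ ^ 2 * mu c v x ≤ 41 / 1000 := by
    calc _ ≤ δ ^ 2 * (1 + r ^ 2) := by gcongr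
      _ = δ ^ 2 + (δ * r) ^ 2 := by ring
      _ ≤ (1 / 50) ^ 2 + (1 / 5) ^ 2 := by gcongr
      _ ≤ _ := by norm_num
  have hc2 : 999 / 1000 ≤ Real.cos δ ^ 2 := by nlinarith
  rw [detector_prob, cond_false]
  set q := ‖((pairStep (walk (V.map (walkEmbed m i₀).toLinearMap) x) δ ^ T)
        (EuclideanSpace.single (i₀, false, none) 1, 0)).2‖ ^ 2
  have hfin : Real.cos δ ^ 2 * q ≤ Real.cos δ ^ 2 * (1 / 3) := by
    nlinarith
  have := le_of_mul_le_mul_left hfin (by linarith)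
  linarith

/-! ### Space bound and degenerate parameters -/

lemma detector_qubits_le (i₀ : Fin n) (V : Submodule ℂ (EuclideanSpace ℂ (WalkBasis n m))) (T : ℕ)
    (hm : 1 ≤ m) : ((detector i₀ V T).qubits : ℝ) ≤ 4 + Real.logb 2 (n * m) := by
  have hn : 1 ≤ n := i₀.pos
  -- The dimension is `4 n (m + 1)`, and `m + 1 ≤ 2 m`.
  have hcard : Fintype.card (Basis n (detector i₀ V T).work) ≤ n * m * 2 ^ 3 := by
    have : (detector i₀ V T).work = 2 * (m + 1) := rfl
    simp only [Fintype.card_prod, Fintype.card_fin, Fintype.card_bool, this]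
    nlinarith
  have hpow : n * m ≤ 2 ^ Nat.clog 2 (n * m) := Nat.le_pow_clog (by norm_num) _
  have h1 : (detector i₀ V T).qubits ≤ Nat.clog 2 (n * m) + 3 := by
    refine (Nat.clog_le_iff_le_pow (by norm_num)).2 (hcard.trans ?_)
    rw [pow_add]; gcongr
  have hnm : 1 ≤ n * m := Nat.mul_pos hn hm
  have h2 : (Nat.clog 2 (n * m) : ℝ) ≤ 1 + Real.logb 2 (n * m) := by
    have := Real.ceil_logb_natCast (b := 2) (r := ((n * m : ℕ) : ℝ)) (Nat.cast_nonneg _)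
    have h3 : ((Nat.clog 2 (n * m) : ℤ) : ℝ) = ⌈Real.logb 2 ((n * m : ℕ) : ℝ)⌉ := by
      rw [← Int.clog_natCast (R := ℝ), ← this, Nat.cast_ofNat]
    have h4 := Int.ceil_lt_add_one (Real.logb 2 ((n * m : ℕ) : ℝ))
    push_cast at h3 h4
    rw [h3]; linarith
  have h5 : ((detector i₀ V T).qubits : ℝ) ≤ Nat.clog 2 (n * m) + 3 := by exact_mod_cast h1
  linarith

/-- With `n = 0` or `m = 0` all weights vanish. Positivity supplies the index `i₀` that hosts `|0̂⟩`
and makes `log (n m)` nonnegative. -/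
lemma pos_of_one_le_size {v : X → Fin n → EuclideanSpace ℂ (Fin m)} (hA : 1 ≤ size v) :
    0 < n ∧ 0 < m := by
  by_contra h
  have h0 : ∀ x, weight v x = 0 := fun x => by
    rw [weight]
    rcases Nat.eq_zero_or_pos n with rfl | hn
    · simp
    · obtain rfl : m = 0 := by omega
      simp [EuclideanSpace.norm_eq]
  have : size v = 0 := by simp [size, h0]
  linarith

lemma finrank_range_toEuclideanLin {ι κ : Type*} [Fintype ι] [Fintype κ] [DecidableEq κ]
    (M : Matrix ι κ ℂ) : Module.finrank ℂ (Matrix.toEuclideanLin M).range = M.rank := by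
  rw [Matrix.toEuclideanLin_eq_toLin_orthonormal]
  exact (M.rank_eq_finrank_range_toLin _ _).symm

end DualAdversary

end

theorem mainTheorem4 (c : ℝ) (hc : 100 ≤ c) :
    ∃ C : ℝ, 0 < C ∧
      ∀ (n m : ℕ) (X : Finset (Fin n → Bool)) (f : X → Bool)
        (v : X → Fin n → EuclideanSpace ℂ (Fin m)) (κ : ℕ),
        1 ≤ DualAdversary.size v →
        1 ≤ κ → κ ≤ (DualAdversary.psiMatrix c f v).rank →
        DualAdversary.crossError c f v ≤
          1 / √(Fintype.card {x : X // f x = true} : ℝ) *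
            (DualAdversary.singVal (DualAdversary.psiMatrix c f v) κ /
                (2 * √c * DualAdversary.size v) -
              DualAdversary.singVal (DualAdversary.psiMatrix c f v) (κ + 1)) →
        DualAdversary.singVal (DualAdversary.psiMatrix c f v) (κ + 1) ≤
          1 / (2 * √(1000 * c) * DualAdversary.size v) →
        ∃ 𝒜 : DualAdversary.QueryAlgorithm n,
          𝒜.Evaluates f ∧
          (𝒜.queries : ℝ) ≤ C * DualAdversary.size v ∧
          (𝒜.qubits : ℝ) ≤ C * (1 + Real.logb 2 (n * m)) := by
  open DualAdversary in
  have hsc : 0 ≤ √c := Real.sqrt_nonneg c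
  -- Two queries per step give at most `16.2 √c A` queries; the `4` covers the additive constant in
  -- the qubit bound.
  refine ⟨17 * √c + 4, by positivity, fun n m X f v κ hA hκ hrank hε hσ => ?_⟩
  obtain ⟨hn, hm⟩ := pos_of_one_le_size hA
  obtain ⟨V, hV1, hV2⟩ := singularSpace_psiMatrix c f v κ
  let i₀ : Fin n := ⟨0, hn⟩
  refine ⟨detector i₀ (V.map (walkEmbed m i₀).toLinearMap) (walkSteps c (size v)), fun x => ?_,
    ?_, ?_⟩
  · have hn1 : (0 : ℝ) < Fintype.card {x : X // f x = true} := by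
      have := (hκ.trans hrank).trans (psiMatrix c f v).rank_le_card_height
      exact_mod_cast this
    -- `κ` is at most the rank, and the zero-based index `κ - 1` is below it; this positivity allows
    -- `s_κ` to be cancelled at the end.
    have hpos : 0 < singVal (psiMatrix c f v) κ := by
      refine (LinearMap.singularValues_pos_iff_lt_finrank_range _).2 ?_
      rw [finrank_range_toEuclideanLin]; omega
    have hnn : 0 ≤ singVal (psiMatrix c f v) (κ + 1) := LinearMap.singularValues_nonneg _ _
    cases hx : f x with
    | true => exact two_thirds_le_prob_true hc hA i₀ V x ((hV1 x hx).trans hσ)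
    | false =>
      refine two_thirds_le_prob_false hc hA i₀ V x ?_
      have h1 := hV2 x hx
      rw [one_div_mul_eq_div, le_div_iff₀' (Real.sqrt_pos.2 hn1)] at hε
      have h2 : singVal (psiMatrix c f v) κ * ‖V.starProjection (conjVec (phi c v x))‖ ≤
          singVal (psiMatrix c f v) κ * (1 / (2 * √c * size v)) := by
        rw [mul_one_div]; linarith
      exact le_of_mul_le_mul_left h2 hpos
  · have h1 := walkSteps_le hc hA
    have h2 : ((detector i₀ (V.map (walkEmbed m i₀).toLinearMap)
        (walkSteps c (size v))).queries : ℝ) = 2 * walkSteps c (size v) := by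
      exact Nat.cast_mul 2 _
    rw [h2]
    nlinarith [mul_nonneg hsc (zero_le_one.trans hA)]
  · refine (detector_qubits_le i₀ _ _ hm).trans ?_
    have : 0 ≤ Real.logb 2 (n * m) := Real.logb_nonneg (by norm_num)
      (by exact_mod_cast Nat.mul_pos hn hm)
    nlinarith
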